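/- For a probability measure $\mu$ on $[0,\infty)$ with $\delta=\mu(\{0\})<1$ put $\psi_\mu(u)=\int_0^\infty \frac{tu}{1-tu}\,d\mu(t)$ for $u<0$; this is a bijection of $(-\infty,0)$ onto $(\delta-1,0)$. Let $\chi_\mu$ be its inverse and let $S_\mu(z)=\frac{z+1}{z}\chi_\mu(z)$, $z\in(\delta-1,0)$, be the $S$-transform of $\mu$. For $\alpha,\beta\ge 0$ let $\mu_{\alpha,\beta}$ denote the probability measure on $(0,\infty)$ whose $S$-transform is $S_{\mu_{\alpha,\beta}}(z)=\frac{(-z)^\beta}{(1+z)^\alpha}$ for $z\in(-1,0)$. Theorem. Let $\alpha>0$. A probability measure $\mu_{\alpha,\alpha}$ with this property exists, and it is necessarily the measure $f_{\alpha,\alpha}(t)\,dt$ on $(0,\infty)$, where $$f_{\alpha,\alpha}(t)=\frac{\sin\left(\frac{\pi}{\alpha+1}\right)}{\pi t\left(t^{\frac1{\alpha+1}}+2\cos\left(\frac{\pi}{\alpha+1}\right)+t^{-\frac1{\alpha+1}}\right)},\qquad t\in(0,\infty).$$ In particular $\mu_{1,1}$ has the density $\frac{1}{\pi\sqrt t\,(1+t)}$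 on $(0,\infty)$, and $\mu_{2,2}$ has the density $\frac{\sqrt3}{2\pi\left(t^{2/3}+t+t^{4/3}\right)}$ on $(0,\infty)$. -/

import Mathlib

open MeasureTheory Set

noncomputable section

/-- The moment transform `ψ_μ(u) = ∫_{[0,∞)} t u / (1 - t u) dμ(t)` of a measure on `[0,∞)`.
For `u < 0` and a finite measure the integrand is bounded, so the integral converges. -/
def psiTransform (μ : Measure ℝ) (u : ℝ) : ℝ :=
  ∫ t in Ici (0 : ℝ), t * u / (1 - t * u) ∂μ

/-- The inverse `χ_μ` of `ψ_μ`. For a probability measure `μ` on `[0,∞)` with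
`δ = μ({0}) < 1` the function `ψ_μ` is a bijection from `(-∞,0)` onto `(δ-1,0)`, and `χ_μ` is
meant on `(δ-1,0)`. -/
def chiTransform (μ : Measure ℝ) (z : ℝ) : ℝ :=
  Function.invFunOn (psiTransform μ) (Iio 0) z

/-- Voiculescu's `S`-transform `S_μ(z) = (z+1)/z * χ_μ(z)`, for `z ∈ (δ-1,0)`. -/
def sTransform (μ : Measure ℝ) (z : ℝ) : ℝ :=
  (z + 1) / z * chiTransform μ z

/-- `μ` is the measure `μ_{α,β}`: a probability measure on `(0,∞)` whose `S`-transform is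
`(-z)^β / (1+z)^α` on `(-1,0)`. -/
structure IsMuAlphaBeta (α β : ℝ) (μ : Measure ℝ) : Prop where
  isProbabilityMeasure : IsProbabilityMeasure μ
  measure_Iic_zero : μ (Iic 0) = 0
  sTransform_eq : ∀ z ∈ Ioo (-1 : ℝ) 0, sTransform μ z = (-z) ^ β / (1 + z) ^ α

/-- `μ` is the measure `f(t) dt` on `(0,∞)`. -/
def HasDensityOnIoi (μ : Measure ℝ) (f : ℝ → ℝ) : Prop :=
  μ = (volume.restrict (Ioi (0 : ℝ))).withDensity fun t => ENNReal.ofReal (f t)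

end

/-! Put `c = 1/(α+1)`, so `0 < c < 1`. When `β = α`, the equation for the S-transform says `χ(z) =
-(-z/(1+z))^(α+1)`, which inverts in closed form: `ψ(-x) = -x^c/(1+x^c)` for `x > 0`
(`isMuAlphaBeta_iff_psiTransform`). It remains to show that `ψ` determines the measure and that the
stated density has this `ψ`.

Uniqueness (`ext_of_psiTransform`): the Taylor coefficients of `1 + ψ` at `u = -1` are differences
of consecutive moments of `v = t/(1+t)`. Since `v` lies in `[0,1]`, its moments fix its law, hence
that of `t`.

Existence: the claim becomes `∫ f(t) t/(t+s) dt = 1/(1+s^c)` (`integral_muDensity_mul`). The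
function `1/(1+w^c)` is holomorphic off the negative axis because `c < 1`, and its jump across that
axis is a multiple of `t f(t)`, so the claim is a Cauchy formula. With `w = e^z` the slit plane
becomes the strip `|Im z| < π`, and the contour is the boundary of a rectangle growing to fill it
(`integral_logDensity`). -/

open scoped Topology

/-! ### Determination of a measure by its moment transform. -/

/-- Two power series with the same sum near `0` coincide. -/
theorem eq_of_eventually_hasSum_pow {a b : ℕ → ℝ} {f : ℝ → ℝ}
    (ha : ∀ᶠ h in 𝓝 (0 : ℝ), HasSum (fun n => h ^ n * a n) (f h))
    (hb : ∀ᶠ h in 𝓝 (0 : ℝ), HasSum (fun n => h ^ n * b n) (f h)) : a = b := by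
  have key : ∀ a : ℕ → ℝ, (∀ᶠ h in 𝓝 (0 : ℝ), HasSum (fun n => h ^ n * a n) (f h)) →
      HasFPowerSeriesAt f (FormalMultilinearSeries.ofScalars ℝ a) 0 := by
    intro a ha
    rw [hasFPowerSeriesAt_iff]
    filter_upwards [ha] with h hh
    simpa [FormalMultilinearSeries.coeff_ofScalars] using hh
  have h := (key a ha).eq_formalMultilinearSeries (key b hb)
  funext n
  have := congrArg (fun p => p.coeff n) h
  simpa [FormalMultilinearSeries.coeff_ofScalars] using this

/-- Probability measures supported in `[0,1]` are determined by their moments. -/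
theorem ext_of_moments {ν₁ ν₂ : Measure ℝ} [IsProbabilityMeasure ν₁] [IsProbabilityMeasure ν₂]
    (h₁ : ∀ᵐ v ∂ν₁, v ∈ Icc (0 : ℝ) 1) (h₂ : ∀ᵐ v ∂ν₂, v ∈ Icc (0 : ℝ) 1)
    (h : ∀ n : ℕ, ∫ v, v ^ n ∂ν₁ = ∫ v, v ^ n ∂ν₂) : ν₁ = ν₂ := by
  -- Since `|v| ≤ 1`, the exponential series integrates term by term with dominating series `∑
  -- |ξ|^n/n!`, so the moments give the characteristic function everywhere.
  have key : ∀ (ν : Measure ℝ) [IsProbabilityMeasure ν], (∀ᵐ v ∂ν, v ∈ Icc (0 : ℝ) 1) → ∀ ξ : ℝ,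
      HasSum (fun n : ℕ => ((ξ * Complex.I) ^ n / (n.factorial : ℂ)) * ((∫ v, v ^ n ∂ν : ℝ) : ℂ))
        (charFun ν ξ) := by
    intro ν _ hν ξ
    have hs := hasSum_integral_of_dominated_convergence (μ := ν)
      (F := fun (n : ℕ) (v : ℝ) => ((ξ * Complex.I) ^ n / (n.factorial : ℂ)) * ((v ^ n : ℝ) : ℂ))
      (f := fun v => Complex.exp (ξ * v * Complex.I))
      (fun n _ => |ξ| ^ n / (n.factorial : ℝ))
      (fun n => by fun_prop)
      (fun n => by
        filter_upwards [hν] with v hv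
        rw [norm_mul, norm_div, norm_pow, norm_mul, Complex.norm_I, Complex.norm_real,
          Complex.norm_natCast, Complex.norm_real, mul_one, Real.norm_eq_abs]
        refine mul_le_of_le_one_right (by positivity) ?_
        rw [Real.norm_eq_abs, abs_of_nonneg (pow_nonneg hv.1 n)]
        exact pow_le_one₀ hv.1 hv.2)
      (by
        filter_upwards with v
        exact Real.summable_pow_div_factorial |ξ|)
      (integrable_const _)
      (by
        filter_upwards with v
        have := NormedSpace.expSeries_div_hasSum_exp (ξ * v * Complex.I : ℂ)
        rw [← Complex.exp_eq_exp_ℂ] at this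
        convert! this using 2 with n
        push_cast
        ring)
    rw [charFun_apply_real]
    convert! hs using 2 with n
    rw [integral_const_mul, integral_complex_ofReal]
  refine Measure.ext_of_charFun (funext fun ξ => ?_)
  refine (key ν₁ h₁ ξ).unique ?_
  simpa only [h] using key ν₂ h₂ ξ

theorem ae_pos_of_measure_Iic_zero {μ : Measure ℝ} (hμ : μ (Iic 0) = 0) : ∀ᵐ t ∂μ, 0 < t := by
  rw [ae_iff]
  simpa [not_lt] using! hμ

theorem psiTransform_eq_integral {μ : Measure ℝ} (hμ : μ (Iic 0) = 0) (u : ℝ) :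
    psiTransform μ u = ∫ t, t * u / (1 - t * u) ∂μ := by
  have : (Ici (0 : ℝ)) =ᵐ[μ] univ := by
    filter_upwards [ae_pos_of_measure_Iic_zero hμ] with t ht
    exact propext ⟨fun _ => trivial, fun _ => ht.le⟩
  rw [psiTransform, setIntegral_congr_set this, setIntegral_univ]

/-- With `v = t/(1+t)` and `u = h - 1`, one has `1 + tu/(1-tu) = (1-v)/(1-hv)`, a geometric series
in `h`. The expansion is at `u = -1` rather than `0` because `v` is bounded while `t` may have no
finite moments. -/
theorem hasSum_psiTransform {μ : Measure ℝ} [IsProbabilityMeasure μ] (hμ : μ (Iic 0) = 0)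
    {h : ℝ} (hh : |h| < 1) :
    HasSum (fun n : ℕ => h ^ n * ((∫ t, (t / (1 + t)) ^ n ∂μ) - ∫ t, (t / (1 + t)) ^ (n + 1) ∂μ))
      (1 + psiTransform μ (h - 1)) := by
  have hpos := ae_pos_of_measure_Iic_zero hμ
  have hv : ∀ t : ℝ, 0 < t → 0 ≤ t / (1 + t) ∧ t / (1 + t) ≤ 1 := fun t ht =>
    ⟨by positivity, (div_le_one (by positivity)).2 (by linarith)⟩
  have hint : ∀ n : ℕ, Integrable (fun t : ℝ => (t / (1 + t)) ^ n) μ := by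
    intro n
    refine Integrable.of_bound (Measurable.aestronglyMeasurable (by fun_prop)) 1 ?_
    filter_upwards [hpos] with t ht
    rw [Real.norm_eq_abs, abs_of_nonneg (pow_nonneg (hv t ht).1 n)]
    exact pow_le_one₀ (hv t ht).1 (hv t ht).2
  have hd : ∀ t : ℝ, 0 < t → 0 < 1 - t * (h - 1) := by
    intro t ht
    nlinarith [(abs_lt.1 hh).2]
  have hs := hasSum_integral_of_dominated_convergence (μ := μ)
      (F := fun (n : ℕ) (t : ℝ) => h ^ n * ((t / (1 + t)) ^ n - (t / (1 + t)) ^ (n + 1)))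
      (f := fun t => 1 + t * (h - 1) / (1 - t * (h - 1)))
      (fun n _ => |h| ^ n)
      (fun n => by fun_prop)
      (fun n => by
        filter_upwards [hpos] with t ht
        rw [norm_mul, norm_pow, Real.norm_eq_abs]
        refine mul_le_of_le_one_right (by positivity) ?_
        have h0 := pow_nonneg (hv t ht).1 n
        have h1 := pow_le_one₀ (n := n) (hv t ht).1 (hv t ht).2
        rw [Real.norm_eq_abs, pow_succ, ← mul_one_sub, abs_le]
        constructor <;> nlinarith [(hv t ht).1, (hv t ht).2])
      (by
        filter_upwards with v
        exact summable_geometric_of_lt_one (abs_nonneg h) hh)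
      (integrable_const _)
      (by
        filter_upwards [hpos] with t ht
        have hlt : |h * (t / (1 + t))| < 1 := by
          rw [abs_mul, abs_of_nonneg (hv t ht).1]
          nlinarith [(hv t ht).1, (hv t ht).2, abs_nonneg h]
        have := (hasSum_geometric_of_abs_lt_one hlt).mul_right (1 - t / (1 + t))
        convert! this using 1
        · funext n
          rw [mul_pow, pow_succ]
          ring
        · have h1 := (hd t ht).ne'
          have h2 : 1 + t ≠ 0 := by positivity
          have h3 : 1 - h * (t / (1 + t)) ≠ 0 := by linarith [(abs_lt.1 hlt).2]
          have h4 : 1 - h * (t / (1 + t)) = (1 - t * (h - 1)) / (1 + t) := by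
            field_simp
            ring
          rw [h4]
          field_simp
          ring)
  convert! hs using 1
  · funext n
    rw [integral_const_mul, integral_sub (hint n) (hint (n + 1))]
  · rw [integral_add (integrable_const _), psiTransform_eq_integral hμ]
    · simp
    · refine Integrable.of_bound (Measurable.aestronglyMeasurable (by fun_prop)) 1 ?_
      filter_upwards [hpos] with t ht
      have h1 := hd t ht
      have h2 := (abs_lt.1 hh).2
      rw [Real.norm_eq_abs, abs_le, le_div_iff₀ h1, div_le_iff₀ h1]
      constructor <;> nlinarith

/-- The moment transform determines a probability measure on `(0,∞)`. -/
theorem ext_of_psiTransform {μ₁ μ₂ : Measure ℝ} [IsProbabilityMeasure μ₁] [IsProbabilityMeasure μ₂]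
    (h₁ : μ₁ (Iic 0) = 0) (h₂ : μ₂ (Iic 0) = 0)
    (h : ∀ u < 0, psiTransform μ₁ u = psiTransform μ₂ u) : μ₁ = μ₂ := by
  have hnear : ∀ᶠ x in 𝓝 (0 : ℝ), |x| < 1 := by
    have := Metric.ball_mem_nhds (0 : ℝ) one_pos
    filter_upwards [this] with x hx
    simpa using hx
  have hd := eq_of_eventually_hasSum_pow
    (f := fun x => 1 + psiTransform μ₁ (x - 1))
    (hnear.mono fun x hx => hasSum_psiTransform h₁ hx)
    (hnear.mono fun x hx => by
      have := hasSum_psiTransform h₂ hx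
      rwa [← h (x - 1) (by linarith [(abs_lt.1 hx).2])] at this)
  -- The coefficients give only differences of consecutive moments; the zeroth moment, equal to 1,
  -- starts the induction.
  have hm : ∀ n : ℕ, ∫ t, (t / (1 + t)) ^ n ∂μ₁ = ∫ t, (t / (1 + t)) ^ n ∂μ₂ := by
    intro n
    induction n with
    | zero => simp
    | succ n ih =>
      have := congrFun hd n
      linarith
  have hφ : Measurable fun t : ℝ => t / (1 + t) := by fun_prop
  have hψ : Measurable fun v : ℝ => v / (1 - v) := by fun_prop
  have hae : ∀ μ : Measure ℝ, μ (Iic 0) = 0 →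
      ∀ᵐ v ∂(μ.map fun t : ℝ => t / (1 + t)), v ∈ Icc (0 : ℝ) 1 := by
    intro μ hμ
    refine (ae_map_iff hφ.aemeasurable measurableSet_Icc).2 ?_
    filter_upwards [ae_pos_of_measure_Iic_zero hμ] with t ht
    exact ⟨by positivity, (div_le_one (by positivity)).2 (by linarith)⟩
  have := Measure.isProbabilityMeasure_map (μ := μ₁) hφ.aemeasurable
  have := Measure.isProbabilityMeasure_map (μ := μ₂) hφ.aemeasurable
  have hmap : μ₁.map (fun t : ℝ => t / (1 + t)) = μ₂.map fun t : ℝ => t / (1 + t) := by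
    refine ext_of_moments (hae μ₁ h₁) (hae μ₂ h₂) fun n => ?_
    rw [integral_map hφ.aemeasurable (by fun_prop), integral_map hφ.aemeasurable (by fun_prop)]
    exact hm n
  have hinv : ∀ μ : Measure ℝ, μ (Iic 0) = 0 →
      (μ.map fun t : ℝ => t / (1 + t)).map (fun v : ℝ => v / (1 - v)) = μ := by
    intro μ hμ
    rw [Measure.map_map hψ hφ]
    conv_rhs => rw [← Measure.map_id (μ := μ)]
    refine Measure.map_congr ?_
    filter_upwards [ae_pos_of_measure_Iic_zero hμ] with t ht
    have h2 : 1 + t ≠ 0 := by positivity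
    have h3 : 1 - t / (1 + t) = 1 / (1 + t) := by
      field_simp
      ring
    simp only [Function.comp, id, h3]
    field_simp
  rw [← hinv μ₁ h₁, hmap, hinv μ₂ h₂]

/-! ### Cauchy's theorem on the strip `|Im z| ≤ π`. -/

section
open Complex Filter

/-- Because `c < 1`, `cz` stays strictly inside the strip where `log` inverts `exp`, while `log (-1)
= πi` lies on its edge. -/
theorem one_add_exp_mul_ne_zero {c : ℝ} (h0 : 0 < c) (h1 : c < 1) {z : ℂ} (hz : |z.im| ≤ Real.pi) :
    1 + exp (c * z) ≠ 0 := by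
  intro h
  have h2 : exp (c * z) = -1 := by linear_combination h
  have him : ((c : ℂ) * z).im = c * z.im := by simp
  have hlt : |c * z.im| < Real.pi := by
    rw [abs_mul, abs_of_pos h0]
    nlinarith [Real.pi_pos, abs_nonneg z.im]
  have h3 := log_exp (x := c * z) (by rw [him]; exact (abs_lt.1 hlt).1)
    (by rw [him]; exact (abs_lt.1 hlt).2.le)
  rw [h2, log_neg_one] at h3
  have h4 := congrArg Complex.im h3
  rw [him] at h4
  simp at h4
  linarith [(abs_lt.1 hlt).2]

theorem eq_ofReal_of_exp_eq {a : ℝ} {z : ℂ} (hz : |z.im| ≤ Real.pi) (h : exp z = exp a) :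
    z = a := by
  obtain ⟨n, hn⟩ := exp_eq_exp_iff_exists_int.1 h
  have him : z.im = n * (2 * Real.pi) := by
    rw [hn]
    simp
  have hn0 : n = 0 := by
    rw [him, abs_mul, abs_of_pos Real.two_pi_pos] at hz
    have h1 : |(n : ℝ)| < 1 := by
      by_contra! hc
      nlinarith [Real.pi_pos]
    have h2 : |n| < 1 := by exact_mod_cast h1
    exact Int.abs_lt_one_iff.1 h2
  simpa [hn0] using hn

/-- The function `z ↦ 1 / (1 + e^{cz})`, i.e. `1 / (1 + w ^ c)` in the coordinate `w = e^z`. -/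
noncomputable def logisticPow (c : ℝ) (z : ℂ) : ℂ := (1 + exp (c * z))⁻¹

/-- The Cauchy kernel, in the coordinate `w = e^z`, applied to `logisticPow`, with its
singularity at `a` removed. -/
noncomputable def cauchyKernel (c a : ℝ) (z : ℂ) : ℂ :=
  exp z * (dslope (logisticPow c) a z / dslope exp a z)

theorem cauchyKernel_of_ne {c a : ℝ} {z : ℂ} (h : z ≠ a) :
    cauchyKernel c a z =
      exp z * ((logisticPow c z - logisticPow c a) / (exp z - exp a)) := by
  rw [cauchyKernel, dslope_of_ne _ h, dslope_of_ne _ h, slope_def_field, slope_def_field,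
    div_div_div_cancel_right₀ (sub_ne_zero.2 h)]

/-- In the closed strip `e^z = e^a` only at `z = a`, where `exp` has nonzero derivative. Both
difference quotients are therefore holomorphic and the denominator never vanishes, so there is no
residue to compute. -/
theorem differentiableOn_cauchyKernel {c : ℝ} (h0 : 0 < c) (h1 : c < 1) (a : ℝ) :
    DifferentiableOn ℂ (cauchyKernel c a) {z | |z.im| ≤ Real.pi} := by
  have hnhds : {z : ℂ | |z.im| ≤ Real.pi} ∈ 𝓝 (a : ℂ) := by
    have hopen : IsOpen {z : ℂ | |z.im| < Real.pi} :=
      isOpen_lt (by fun_prop) continuous_const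
    refine mem_of_superset (hopen.mem_nhds ?_) fun z (hz : |z.im| < Real.pi) => (le_of_lt hz : |z.im| ≤ Real.pi)
    simpa using Real.pi_pos
  refine differentiable_exp.differentiableOn.mul (DifferentiableOn.div ?_ ?_ ?_)
  · refine (differentiableOn_dslope hnhds).2 ?_
    intro z hz
    refine DifferentiableAt.differentiableWithinAt ?_
    unfold logisticPow
    exact DifferentiableAt.inv (by fun_prop) (one_add_exp_mul_ne_zero h0 h1 hz)
  · exact (differentiableOn_dslope hnhds).2 differentiable_exp.differentiableOn
  · intro z hz
    by_cases h : z = a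
    · rw [h, dslope_same]
      simp [exp_ne_zero]
    · rw [dslope_of_ne _ h, slope_def_field]
      exact div_ne_zero (sub_ne_zero.2 fun h2 => h (eq_ofReal_of_exp_eq hz h2)) (sub_ne_zero.2 h)

/-- The density of `log t` under `t ↦ f(t) dt`, up to the factor `π`. -/
noncomputable def logDensity (c x : ℝ) : ℝ :=
  Real.exp (c * x) * Real.sin (Real.pi * c) /
    (1 + 2 * Real.exp (c * x) * Real.cos (Real.pi * c) + Real.exp (c * x) ^ 2)

/-- On both edges `e^z = -e^x`, so the Cauchy factor agrees and the constant `logisticPow c a`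
cancels; only the jump of `1/(1+w^c)` across the cut survives. -/
theorem cauchyKernel_sub {c : ℝ} (h0 : 0 < c) (h1 : c < 1) (a x : ℝ) :
    cauchyKernel c a (x + (-Real.pi : ℝ) * I) - cauchyKernel c a (x + Real.pi * I) =
      2 * I * ((Real.exp x / (Real.exp x + Real.exp a) * logDensity c x : ℝ) : ℂ) := by
  have hp1 : exp ((x : ℂ) + (-Real.pi : ℝ) * I) = -exp x := by
    rw [exp_add]; push_cast; rw [neg_mul, exp_neg, exp_pi_mul_I]; norm_num
  have hp2 : exp ((x : ℂ) + Real.pi * I) = -exp x := by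
    rw [exp_add, exp_pi_mul_I]; norm_num
  have hn1 : (x : ℂ) + (-Real.pi : ℝ) * I ≠ a := by
    intro h
    have := congrArg Complex.im h
    simp [Real.pi_ne_zero] at this
  have hn2 : (x : ℂ) + Real.pi * I ≠ a := by
    intro h
    have := congrArg Complex.im h
    simp [Real.pi_ne_zero] at this
  have hz1 := one_add_exp_mul_ne_zero h0 h1 (z := (x : ℂ) + (-Real.pi : ℝ) * I)
    (by simp [abs_of_pos Real.pi_pos])
  have hz2 := one_add_exp_mul_ne_zero h0 h1 (z := (x : ℂ) + Real.pi * I)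
    (by simp [abs_of_pos Real.pi_pos])
  have he1 : exp ((c : ℂ) * (x + (-Real.pi : ℝ) * I)) =
      exp (c * x) * (cos (Real.pi * c) - sin (Real.pi * c) * I) := by
    rw [mul_add, exp_add,
      show (c : ℂ) * ((-Real.pi : ℝ) * I) = (-(Real.pi * c)) * I by push_cast; ring, exp_mul_I,
      cos_neg, sin_neg]
    ring
  have he2 : exp ((c : ℂ) * (x + Real.pi * I)) =
      exp (c * x) * (cos (Real.pi * c) + sin (Real.pi * c) * I) := by
    rw [mul_add, exp_add, show (c : ℂ) * (Real.pi * I) = (Real.pi * c) * I by ring, exp_mul_I]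
  rw [cauchyKernel_of_ne hn1, cauchyKernel_of_ne hn2, hp1, hp2]
  unfold logisticPow logDensity
  rw [he1] at hz1 ⊢
  rw [he2] at hz2 ⊢
  push_cast
  have hE : exp (x : ℂ) + exp a ≠ 0 := by
    have : Real.exp x + Real.exp a ≠ 0 := by positivity
    exact_mod_cast this
  have hE' : -exp (x : ℂ) - exp a ≠ 0 := by
    intro h; apply hE; linear_combination -h
  set C := cos ((Real.pi : ℂ) * c)
  set S := sin ((Real.pi : ℂ) * c)
  set r := exp ((c : ℂ) * x)
  have hCS : C ^ 2 + S ^ 2 = 1 := cos_sq_add_sin_sq _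
  -- The denominator of `logDensity` is the product of the conjugate values of `1 + w^c` on the two
  -- sides of the cut.
  have hprod : 1 + 2 * r * C + r ^ 2 = (1 + r * (C - S * I)) * (1 + r * (C + S * I)) := by
    linear_combination (-r ^ 2) * hCS + r ^ 2 * S ^ 2 * I_sq
  have hE'' : -exp (x : ℂ) - exp a = - (exp (x : ℂ) + exp a) := by ring
  rw [hprod, hE'']
  generalize (1 + exp ((c : ℂ) * a))⁻¹ = g
  field_simp
  ring

theorem norm_exp_add_mul_I (x y : ℝ) : ‖exp ((x : ℂ) + y * I)‖ = Real.exp x := by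
  rw [norm_exp]; simp

theorem norm_exp_mul_add_mul_I (c x y : ℝ) :
    ‖exp ((c : ℂ) * ((x : ℂ) + y * I))‖ = Real.exp (c * x) := by
  rw [norm_exp]; simp

theorem tendsto_logisticPow_atTop {c : ℝ} (h0 : 0 < c) (y : ℝ) :
    Tendsto (fun x : ℝ => logisticPow c (x + y * I)) atTop (𝓝 0) := by
  unfold logisticPow
  refine Tendsto.comp tendsto_inv₀_cobounded ?_
  refine tendsto_norm_atTop_iff_cobounded.1 ?_
  refine tendsto_atTop_mono (f := fun x : ℝ => Real.exp (c * x) - 1) (fun x => ?_) ?_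
  · have := norm_sub_le_norm_add (exp ((c : ℂ) * ((x : ℂ) + y * I))) 1
    rw [norm_exp_mul_add_mul_I, norm_one] at this
    rwa [add_comm 1]
  · exact tendsto_atTop_add_const_right _ _
      (Real.tendsto_exp_atTop.comp (tendsto_id.const_mul_atTop h0))

theorem tendsto_exp_div_atTop (a y : ℝ) :
    Tendsto (fun x : ℝ => exp ((x : ℂ) + y * I) / (exp ((x : ℂ) + y * I) - exp a))
      atTop (𝓝 1) := by
  have h : Tendsto (fun x : ℝ => (1 - exp a * (exp ((x : ℂ) + y * I))⁻¹)⁻¹) atTop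
      (𝓝 (1 - exp a * 0)⁻¹) := by
    refine Tendsto.inv₀ (tendsto_const_nhds.sub (tendsto_const_nhds.mul ?_)) (by simp)
    refine Tendsto.comp tendsto_inv₀_cobounded (tendsto_norm_atTop_iff_cobounded.1 ?_)
    simp only [norm_exp_add_mul_I]
    exact Real.tendsto_exp_atTop
  rw [mul_zero, sub_zero, inv_one] at h
  refine h.congr fun x => ?_
  have hne := exp_ne_zero ((x : ℂ) + y * I)
  rw [← inv_div, sub_div, div_self hne, div_eq_mul_inv (exp (a : ℂ))]

theorem tendsto_exp_div_atBot (a y : ℝ) :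
    Tendsto (fun x : ℝ => exp ((x : ℂ) + y * I) / (exp ((x : ℂ) + y * I) - exp a))
      atBot (𝓝 0) := by
  have h0 : Tendsto (fun x : ℝ => exp ((x : ℂ) + y * I)) atBot (𝓝 0) := by
    rw [tendsto_zero_iff_norm_tendsto_zero]
    simp only [norm_exp_add_mul_I]
    exact Real.tendsto_exp_atBot
  have := h0.div (h0.sub_const (exp (a : ℂ))) (by simp [exp_ne_zero])
  rw [zero_div] at this
  exact this

theorem tendsto_logisticPow_atBot {c : ℝ} (h0 : 0 < c) (y : ℝ) :
    Tendsto (fun x : ℝ => logisticPow c (x + y * I)) atBot (𝓝 1) := by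
  have h : Tendsto (fun x : ℝ => exp ((c : ℂ) * ((x : ℂ) + y * I))) atBot (𝓝 0) := by
    rw [tendsto_zero_iff_norm_tendsto_zero]
    simp only [norm_exp_mul_add_mul_I]
    exact Real.tendsto_exp_atBot.comp (tendsto_id.const_mul_atBot h0)
  have := (h.const_add 1).inv₀ (by simp)
  simpa [logisticPow] using this

theorem norm_one_add_inv_le {w : ℂ} (hw : 2 ≤ ‖w‖ ∨ ‖w‖ ≤ 1 / 2) : ‖(1 + w)⁻¹‖ ≤ 2 := by
  have h1 := norm_sub_le_norm_add w 1
  have h2 := norm_sub_le_norm_add 1 w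
  rw [norm_one] at h1 h2
  rw [add_comm w] at h1
  have h3 : 1 / 2 ≤ ‖1 + w‖ := by rcases hw with hw | hw <;> linarith
  rw [norm_inv]
  exact (inv_anti₀ (by norm_num) h3).trans (by norm_num)

theorem norm_div_sub_le {w b : ℂ} (hb : b ≠ 0) (hw : 2 * ‖b‖ ≤ ‖w‖ ∨ ‖w‖ ≤ ‖b‖ / 2) :
    ‖w / (w - b)‖ ≤ 2 := by
  have h1 := norm_sub_norm_le w b
  have h2 := norm_sub_norm_le b w
  rw [norm_sub_rev] at h2
  have hb' := norm_pos_iff.2 hb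
  rw [norm_div, div_le_iff₀ (by rcases hw with hw | hw <;> linarith)]
  rcases hw with hw | hw <;> linarith

theorem norm_cauchyKernel_le {c a x : ℝ} (y : ℝ) (hx : x ≠ a)
    (h1 : 2 ≤ Real.exp (c * x) ∨ Real.exp (c * x) ≤ 1 / 2)
    (h2 : 2 * Real.exp a ≤ Real.exp x ∨ Real.exp x ≤ Real.exp a / 2) :
    ‖cauchyKernel c a (x + y * I)‖ ≤ 2 * (2 + ‖logisticPow c a‖) := by
  have hne : (x : ℂ) + y * I ≠ a := by
    intro h
    apply hx
    simpa using congrArg Complex.re h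
  have hG : ‖logisticPow c (x + y * I)‖ ≤ 2 :=
    norm_one_add_inv_le (by rwa [norm_exp_mul_add_mul_I])
  have hK : ‖exp ((x : ℂ) + y * I) / (exp ((x : ℂ) + y * I) - exp a)‖ ≤ 2 :=
    norm_div_sub_le (exp_ne_zero _)
      (by rw [norm_exp_add_mul_I, norm_exp, ofReal_re]; exact h2)
  rw [cauchyKernel_of_ne hne, mul_div_left_comm, mul_comm, norm_mul]
  exact mul_le_mul hK ((norm_sub_le _ _).trans (by linarith)) (norm_nonneg _) (by norm_num)

/-- Treats both vertical sides at once, by dominated convergence: `A` and `B` are the limits of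
`1/(1+w^c)` and of `w/(w-e^a)`, namely `0, 1` at the right end and `1, 0` at the left. Only the
right side contributes in the limit. -/
theorem tendsto_integral_cauchyKernel {c a : ℝ} (h0 : 0 < c) (h1 : c < 1) {l : Filter ℝ}
    [l.IsCountablyGenerated] {A B : ℂ} (hne : ∀ᶠ x in l, x ≠ a)
    (hl1 : ∀ᶠ x in l, 2 ≤ Real.exp (c * x) ∨ Real.exp (c * x) ≤ 1 / 2)
    (hl2 : ∀ᶠ x in l, 2 * Real.exp a ≤ Real.exp x ∨ Real.exp x ≤ Real.exp a / 2)
    (hA : ∀ y : ℝ, Tendsto (fun x : ℝ => logisticPow c (x + y * I)) l (𝓝 A))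
    (hB : ∀ y : ℝ, Tendsto
      (fun x : ℝ => exp ((x : ℂ) + y * I) / (exp ((x : ℂ) + y * I) - exp a)) l (𝓝 B)) :
    Tendsto (fun x : ℝ => ∫ y in (-Real.pi)..Real.pi, cauchyKernel c a (x + y * I)) l
      (𝓝 (2 * Real.pi * (B * (A - logisticPow c a)))) := by
  have hlim : (2 * Real.pi * (B * (A - logisticPow c a)) : ℂ) =
      ∫ _ in (-Real.pi)..Real.pi, B * (A - logisticPow c a) := by
    rw [intervalIntegral.integral_const, sub_neg_eq_add, ← two_mul, real_smul]
    push_cast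
    ring
  rw [hlim]
  refine intervalIntegral.tendsto_integral_filter_of_dominated_convergence
    (fun _ => 2 * (2 + ‖logisticPow c a‖)) ?_ ?_ (by simp) ?_
  · refine Eventually.of_forall fun x => ?_
    refine ContinuousOn.aestronglyMeasurable ?_ measurableSet_uIoc
    refine (differentiableOn_cauchyKernel h0 h1 a).continuousOn.comp (by fun_prop) ?_
    intro y hy
    rw [uIoc_of_le (by linarith [Real.pi_pos])] at hy
    have : |y| ≤ Real.pi := abs_le.2 ⟨hy.1.le, hy.2⟩
    simpa using this
  · filter_upwards [hne, hl1, hl2] with x hx hx1 hx2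
    exact Eventually.of_forall fun y _ => norm_cauchyKernel_le y hx hx1 hx2
  · refine Eventually.of_forall fun y _ => ?_
    refine ((hB y).mul ((hA y).sub_const (logisticPow c a))).congr' ?_
    filter_upwards [hne] with x hx
    rw [cauchyKernel_of_ne, mul_div_left_comm, mul_comm]
    intro h
    apply hx
    simpa using congrArg Complex.re h

theorem tendsto_integral_cauchyKernel_atTop {c : ℝ} (h0 : 0 < c) (h1 : c < 1) (a : ℝ) :
    Tendsto (fun x : ℝ => ∫ y in (-Real.pi)..Real.pi, cauchyKernel c a (x + y * I)) atTop
      (𝓝 (2 * Real.pi * (1 * (0 - logisticPow c a)))) :=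
  tendsto_integral_cauchyKernel h0 h1 (eventually_ne_atTop a)
    (((Real.tendsto_exp_atTop.comp (tendsto_id.const_mul_atTop h0)).eventually_ge_atTop 2).mono
      fun _ h => Or.inl h)
    ((Real.tendsto_exp_atTop.eventually_ge_atTop (2 * Real.exp a)).mono fun _ h => Or.inl h)
    (tendsto_logisticPow_atTop h0) (tendsto_exp_div_atTop a)

theorem tendsto_integral_cauchyKernel_atBot {c : ℝ} (h0 : 0 < c) (h1 : c < 1) (a : ℝ) :
    Tendsto (fun x : ℝ => ∫ y in (-Real.pi)..Real.pi, cauchyKernel c a (x + y * I)) atBot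
      (𝓝 (2 * Real.pi * (0 * (1 - logisticPow c a)))) :=
  tendsto_integral_cauchyKernel h0 h1 (eventually_ne_atBot a)
    (((Real.tendsto_exp_atBot.comp (tendsto_id.const_mul_atBot h0)).eventually_le_const
      (by norm_num : (0 : ℝ) < 1 / 2)).mono fun _ h => Or.inr h)
    ((Real.tendsto_exp_atBot.eventually_le_const (half_pos (Real.exp_pos a))).mono
      fun _ h => Or.inr h)
    (tendsto_logisticPow_atBot h0) (tendsto_exp_div_atBot a)

theorem intervalIntegral_logDensity {c : ℝ} (h0 : 0 < c) (h1 : c < 1) (a R : ℝ) :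
    2 * I * ((∫ x in (-R)..R, Real.exp x / (Real.exp x + Real.exp a) * logDensity c x : ℝ) : ℂ) +
        I * (∫ y in (-Real.pi)..Real.pi, cauchyKernel c a (R + y * I)) -
        I * (∫ y in (-Real.pi)..Real.pi, cauchyKernel c a ((-R : ℝ) + y * I)) = 0 := by
  have hd := differentiableOn_cauchyKernel h0 h1 a
  have hc := integral_boundary_rect_eq_zero_of_differentiableOn (cauchyKernel c a)
    ⟨-R, -Real.pi⟩ ⟨R, Real.pi⟩ (hd.mono fun z hz => by
      have := hz.2
      simp only [mem_preimage, uIcc_of_le (by linarith [Real.pi_pos] : -Real.pi ≤ Real.pi)] at this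
      exact abs_le.2 this)
  simp only [smul_eq_mul] at hc
  have hi : ∀ b : ℝ, |b| ≤ Real.pi →
      IntervalIntegrable (fun x : ℝ => cauchyKernel c a (x + b * I)) volume (-R) R := by
    intro b hb
    refine Continuous.intervalIntegrable ?_ _ _
    refine hd.continuousOn.comp_continuous (by fun_prop) fun x => ?_
    simpa using hb
  rw [← intervalIntegral.integral_sub (hi _ (by simp [abs_of_pos Real.pi_pos]))
    (hi _ (by simp [abs_of_pos Real.pi_pos]))] at hc
  simp only [cauchyKernel_sub h0 h1] at hc
  rw [intervalIntegral.integral_const_mul, intervalIntegral.integral_ofReal] at hc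
  exact hc

theorem integral_logDensity {c : ℝ} (h0 : 0 < c) (h1 : c < 1) (a : ℝ)
    (hint : Integrable fun x => Real.exp x / (Real.exp x + Real.exp a) * logDensity c x) :
    ∫ x, Real.exp x / (Real.exp x + Real.exp a) * logDensity c x =
      Real.pi / (1 + Real.exp (c * a)) := by
  have hT := intervalIntegral_tendsto_integral hint tendsto_neg_atTop_atBot tendsto_id
  have hT' := (continuous_ofReal.tendsto _).comp hT
  have hlim := ((hT'.const_mul (2 * I)).add
    ((tendsto_integral_cauchyKernel_atTop h0 h1 a).const_mul I)).sub
    (((tendsto_integral_cauchyKernel_atBot h0 h1 a).comp tendsto_neg_atTop_atBot).const_mul I)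
  have hzero := tendsto_nhds_unique (hlim.congr fun R => intervalIntegral_logDensity h0 h1 a R)
    tendsto_const_nhds
  have h2 : ((∫ x, Real.exp x / (Real.exp x + Real.exp a) * logDensity c x : ℝ) : ℂ) =
      Real.pi * logisticPow c a := by
    have h2I : (2 * I : ℂ) ≠ 0 := by simp
    apply mul_left_cancel₀ h2I
    linear_combination hzero
  have h3 : (Real.pi : ℂ) * logisticPow c a = ((Real.pi / (1 + Real.exp (c * a)) : ℝ) : ℂ) := by
    unfold logisticPow
    push_cast
    rw [div_eq_mul_inv]
  exact ofReal_injective (h2.trans h3)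

end

/-! ### The density: total mass and Stieltjes transform. -/

section
open Real Filter

/-- The density `f_{α,α}`, with `c = 1 / (α + 1)`. -/
noncomputable def muDensity (c t : ℝ) : ℝ :=
  sin (π * c) / (π * t * (t ^ c + 2 * cos (π * c) + t ^ (-c)))

theorem sin_pi_mul_pos {c : ℝ} (h0 : 0 < c) (h1 : c < 1) : 0 < sin (π * c) :=
  sin_pos_of_pos_of_lt_pi (by positivity) (by nlinarith [pi_pos])

theorem sq_add_pos {c : ℝ} (h0 : 0 < c) (h1 : c < 1) (r : ℝ) :
    0 < 1 + 2 * r * cos (π * c) + r ^ 2 := by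
  nlinarith [sin_sq_add_cos_sq (π * c), sin_pi_mul_pos h0 h1, sq_nonneg (r + cos (π * c)),
    pow_pos (sin_pi_mul_pos h0 h1) 2]

theorem muDensity_eq {c t : ℝ} (ht : 0 < t) :
    muDensity c t =
      t ^ c * sin (π * c) / (π * t * (1 + 2 * t ^ c * cos (π * c) + (t ^ c) ^ 2)) := by
  have hr : 0 < t ^ c := rpow_pos_of_pos ht c
  have : t ^ c + 2 * cos (π * c) + (t ^ c)⁻¹ =
      (1 + 2 * t ^ c * cos (π * c) + (t ^ c) ^ 2) / t ^ c := by
    field_simp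
    ring
  rw [muDensity, rpow_neg ht.le, this]
  rw [← mul_div_assoc, div_div_eq_mul_div, mul_comm (sin _)]

theorem muDensity_nonneg {c t : ℝ} (h0 : 0 < c) (h1 : c < 1) (ht : 0 < t) :
    0 ≤ muDensity c t := by
  rw [muDensity_eq ht]
  have := sq_add_pos h0 h1 (t ^ c)
  have := sin_pi_mul_pos h0 h1
  positivity

/-- Completing the square, `1 + 2r cos(πc) + r² = (r + cos(πc))² + sin²(πc)` with `r = t^c`, yields
an explicit antiderivative. -/
theorem hasDerivAt_arctan_rpow {c t : ℝ} (h0 : 0 < c) (h1 : c < 1) (ht : 0 < t) :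
    HasDerivAt (fun t => arctan ((t ^ c + cos (π * c)) / sin (π * c)) / (π * c))
      (muDensity c t) t := by
  have hs := sin_pi_mul_pos h0 h1
  have h := ((((hasDerivAt_rpow_const (p := c) (Or.inl ht.ne')).add_const
    (cos (π * c))).div_const (sin (π * c))).arctan).div_const (π * c)
  convert! h using 1
  have hq := sq_add_pos h0 h1 (t ^ c)
  have hsq : 1 + ((t ^ c + cos (π * c)) / sin (π * c)) ^ 2 =
      (1 + 2 * t ^ c * cos (π * c) + (t ^ c) ^ 2) / sin (π * c) ^ 2 := by
    field_simp
    linear_combination sin_sq_add_cos_sq (π * c)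
  rw [muDensity_eq ht, hsq, rpow_sub_one ht.ne']
  field_simp

theorem arctan_cos_div_sin {c : ℝ} (h0 : 0 < c) (h1 : c < 1) :
    arctan (cos (π * c) / sin (π * c)) = π / 2 - π * c := by
  rw [← cos_pi_div_two_sub (π * c), ← sin_pi_div_two_sub (π * c), ← tan_eq_sin_div_cos]
  exact arctan_tan (by nlinarith [pi_pos]) (by nlinarith [pi_pos])

theorem integrableOn_muDensity_and_integral {c : ℝ} (h0 : 0 < c) (h1 : c < 1) :
    IntegrableOn (muDensity c) (Ioi 0) ∧ ∫ t in Ioi 0, muDensity c t = 1 := by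
  have hs := sin_pi_mul_pos h0 h1
  have hcont : ContinuousWithinAt
      (fun t => arctan ((t ^ c + cos (π * c)) / sin (π * c)) / (π * c)) (Ici 0) 0 := by
    have : Continuous fun t : ℝ => t ^ c := continuous_rpow_const h0.le
    fun_prop
  have hlim : Tendsto (fun t : ℝ => arctan ((t ^ c + cos (π * c)) / sin (π * c)) / (π * c)) atTop
      (𝓝 (π / 2 / (π * c))) := by
    refine Tendsto.div_const ?_ _
    refine (tendsto_arctan_atTop.mono_right nhdsWithin_le_nhds).comp ?_
    exact (tendsto_atTop_add_const_right _ _ (tendsto_rpow_atTop h0)).atTop_div_const hs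
  have hd : ∀ t ∈ Ioi (0 : ℝ), HasDerivAt
      (fun t => arctan ((t ^ c + cos (π * c)) / sin (π * c)) / (π * c)) (muDensity c t) t :=
    fun t ht => hasDerivAt_arctan_rpow h0 h1 ht
  have hn : ∀ t ∈ Ioi (0 : ℝ), 0 ≤ muDensity c t := fun t ht => muDensity_nonneg h0 h1 ht
  refine ⟨integrableOn_Ioi_deriv_of_nonneg hcont hd hn hlim, ?_⟩
  -- The arctangent rises from `π/2 - πc` at `0` to `π/2` at infinity, a gain of `πc`.
  rw [integral_Ioi_of_hasDerivAt_of_nonneg hcont hd hn hlim, zero_rpow h0.ne', zero_add,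
    arctan_cos_div_sin h0 h1]
  have := pi_pos
  field_simp
  ring

theorem exp_mul_muDensity_exp (c x : ℝ) : exp x * muDensity c (exp x) = logDensity c x / π := by
  have h := exp_pos x
  rw [muDensity_eq h, logDensity, ← exp_mul, mul_comm x c, div_div]
  have := pi_pos
  field_simp

theorem integral_Ioi_eq_integral_exp (g : ℝ → ℝ) :
    ∫ t in Ioi 0, g t = ∫ x, exp x * g (exp x) := by
  have := integral_image_eq_integral_abs_deriv_smul MeasurableSet.univ
    (fun x _ => (hasDerivAt_exp x).hasDerivWithinAt) exp_injective.injOn g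
  simpa [abs_of_pos (exp_pos _)] using this

theorem integrableOn_Ioi_iff_integrable_exp (g : ℝ → ℝ) :
    IntegrableOn g (Ioi 0) ↔ Integrable fun x => exp x * g (exp x) := by
  have := integrableOn_image_iff_integrableOn_abs_deriv_smul MeasurableSet.univ
    (fun x _ => (hasDerivAt_exp x).hasDerivWithinAt) exp_injective.injOn g
  simpa [abs_of_pos (exp_pos _)] using this

/-- The Stieltjes transform of `t f_{α,α}(t) dt`. -/
theorem integral_muDensity_mul {c s : ℝ} (h0 : 0 < c) (h1 : c < 1) (hs : 0 < s) :
    ∫ t in Ioi 0, muDensity c t * (t / (t + s)) = 1 / (1 + s ^ c) := by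
  have hfun : ∀ x, exp x * (muDensity c (exp x) * (exp x / (exp x + s))) =
      π⁻¹ * (exp x / (exp x + exp (log s)) * logDensity c x) := by
    intro x
    rw [← mul_assoc, exp_mul_muDensity_exp, exp_log hs]
    ring
  have hint : Integrable fun x => exp x / (exp x + exp (log s)) * logDensity c x := by
    have h := (integrableOn_Ioi_iff_integrable_exp _).1
      (integrableOn_muDensity_and_integral h0 h1).1
    simp only [exp_mul_muDensity_exp] at h
    have h' : Integrable (logDensity c) := by
      simpa [div_mul_cancel₀ _ pi_ne_zero] using h.mul_const π
    refine h'.bdd_mul (c := 1) (Measurable.aestronglyMeasurable (by fun_prop))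
      (Eventually.of_forall fun x => ?_)
    have h1 := exp_pos x
    have h2 := exp_pos (log s)
    rw [norm_of_nonneg (by positivity), div_le_one (by positivity)]
    linarith
  rw [integral_Ioi_eq_integral_exp]
  simp only [hfun]
  rw [integral_const_mul, integral_logDensity h0 h1 _ hint, rpow_def_of_pos hs, mul_comm c]
  field_simp

/-- The measure `f_{α,α}(t) dt` on `(0,∞)`, with `c = 1 / (α + 1)`. -/
noncomputable def muMeasure (c : ℝ) : Measure ℝ :=
  (volume.restrict (Ioi (0 : ℝ))).withDensity fun t => ENNReal.ofReal (muDensity c t)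

theorem measurable_muDensity (c : ℝ) : Measurable (muDensity c) := by
  unfold muDensity
  fun_prop

theorem isProbabilityMeasure_muMeasure {c : ℝ} (h0 : 0 < c) (h1 : c < 1) :
    IsProbabilityMeasure (muMeasure c) := by
  have h := integrableOn_muDensity_and_integral h0 h1
  constructor
  rw [muMeasure, withDensity_apply _ MeasurableSet.univ, Measure.restrict_univ,
    ← ofReal_integral_eq_lintegral_ofReal h.1, h.2, ENNReal.ofReal_one]
  filter_upwards [ae_restrict_mem measurableSet_Ioi] with t ht
  exact muDensity_nonneg h0 h1 ht

theorem muMeasure_Iic_zero (c : ℝ) : muMeasure c (Iic 0) = 0 := by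
  refine withDensity_absolutelyContinuous _ _ ?_
  rw [Measure.restrict_apply measurableSet_Iic, Iic_inter_Ioi, Ioc_self, measure_empty]

/-- The Stieltjes transform at `s = 1/x`, since `tx/(1+tx) = t/(t+1/x)`. -/
theorem psiTransform_muMeasure {c x : ℝ} (h0 : 0 < c) (h1 : c < 1) (hx : 0 < x) :
    psiTransform (muMeasure c) (-x) = -(x ^ c / (1 + x ^ c)) := by
  rw [psiTransform_eq_integral (muMeasure_Iic_zero c), muMeasure,
    integral_withDensity_eq_integral_toReal_smul
      (measurable_muDensity c).ennreal_ofReal (Eventually.of_forall fun _ => ENNReal.ofReal_lt_top)]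
  have h := integral_muDensity_mul h0 h1 (inv_pos.2 hx)
  have hr := rpow_pos_of_pos hx c
  rw [inv_rpow hx.le] at h
  have h2 : x ^ c / (1 + x ^ c) = 1 / (1 + (x ^ c)⁻¹) := by
    field_simp
    ring
  rw [h2, ← h, ← integral_neg]
  refine setIntegral_congr_fun measurableSet_Ioi fun t (ht : 0 < t) => ?_
  simp only [ENNReal.toReal_ofReal (muDensity_nonneg h0 h1 ht), smul_eq_mul]
  rw [← mul_neg]
  congr 1
  have h3 : 1 - t * -x ≠ 0 := by nlinarith [mul_pos ht hx]
  have h4 : t + x⁻¹ ≠ 0 := by positivity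
  have h5 : t + x⁻¹ = (1 - t * -x) / x := by
    field_simp
    ring
  rw [h5]
  field_simp

/-! ### From the S-transform to the moment transform. -/

theorem tendsto_psiTransform {μ : Measure ℝ} [IsProbabilityMeasure μ] (hμ : μ (Iic 0) = 0)
    {l : Filter ℝ} [l.IsCountablyGenerated] {A : ℝ} (hl : ∀ᶠ u in l, u ≤ 0)
    (h : ∀ t > 0, Tendsto (fun u => t * u / (1 - t * u)) l (𝓝 A)) :
    Tendsto (psiTransform μ) l (𝓝 A) := by
  have hA : A = ∫ _, A ∂μ := by simp
  rw [hA, show psiTransform μ = fun u => ∫ t, t * u / (1 - t * u) ∂μ from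
    funext (psiTransform_eq_integral hμ)]
  refine tendsto_integral_filter_of_dominated_convergence (fun _ => 1)
    (Eventually.of_forall fun u => Measurable.aestronglyMeasurable (by fun_prop)) ?_
    (integrable_const _) ?_
  · filter_upwards [hl] with u hu
    filter_upwards [ae_pos_of_measure_Iic_zero hμ] with t ht
    have h1 : 0 < 1 - t * u := by nlinarith
    rw [norm_eq_abs, abs_le, le_div_iff₀ h1, div_le_iff₀ h1]
    constructor <;> nlinarith
  · filter_upwards [ae_pos_of_measure_Iic_zero hμ] with t ht
    exact h t ht

/-- Continuity and the limits `-1` at `-∞` and `0` at `0⁻` give surjectivity onto `(-1,0)`; the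
lower limit is `-1` because there is no mass at `0`. Surjectivity makes the value of `invFunOn` a
genuine preimage, and injectivity is not needed. -/
theorem exists_psiTransform_eq {μ : Measure ℝ} [IsProbabilityMeasure μ] (hμ : μ (Iic 0) = 0)
    {z : ℝ} (hz : z ∈ Ioo (-1 : ℝ) 0) : ∃ u ∈ Iio (0 : ℝ), psiTransform μ u = z := by
  have hne : ∀ t > (0 : ℝ), ∀ u ≤ (0 : ℝ), 1 - t * u ≠ 0 := fun t ht u hu => by nlinarith
  have hat : ∀ t > (0 : ℝ), ∀ u ≤ (0 : ℝ), ContinuousAt (fun u : ℝ => t * u / (1 - t * u)) u :=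
    fun t ht u hu => ContinuousAt.div (by fun_prop) (by fun_prop) (hne t ht u hu)
  have hcont : ContinuousOn (psiTransform μ) (Iio 0) := by
    intro u hu
    have hu' : u < 0 := hu
    rw [ContinuousWithinAt, psiTransform_eq_integral hμ]
    have key : Tendsto (fun v => ∫ t, t * v / (1 - t * v) ∂μ) (𝓝[Iio 0] u)
        (𝓝 (∫ t, t * u / (1 - t * u) ∂μ)) := by
      refine tendsto_integral_filter_of_dominated_convergence (fun _ => 1)
        (Eventually.of_forall fun u => Measurable.aestronglyMeasurable (by fun_prop)) ?_
        (integrable_const _) ?_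
      · filter_upwards [self_mem_nhdsWithin] with v hv
        have hv' : v < 0 := hv
        filter_upwards [ae_pos_of_measure_Iic_zero hμ] with t ht
        have h1 : 0 < 1 - t * v := by nlinarith
        rw [norm_eq_abs, abs_le, le_div_iff₀ h1, div_le_iff₀ h1]
        constructor <;> nlinarith
      · filter_upwards [ae_pos_of_measure_Iic_zero hμ] with t ht
        exact (hat t ht u hu'.le).tendsto.mono_left nhdsWithin_le_nhds
    exact key.congr fun v => (psiTransform_eq_integral hμ v).symm
  have hbot : Tendsto (psiTransform μ) atBot (𝓝 (-1)) := by
    refine tendsto_psiTransform hμ (eventually_le_atBot 0) fun t ht => ?_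
    have h1 : Tendsto (fun u : ℝ => (1 - t * u)⁻¹ - 1) atBot (𝓝 (0 - 1)) := by
      refine Tendsto.sub_const (tendsto_inv_atTop_zero.comp ?_) 1
      have : Tendsto (fun u : ℝ => -(t * u)) atBot atTop :=
        tendsto_neg_atBot_atTop.comp (tendsto_id.const_mul_atBot ht)
      exact (tendsto_atTop_add_const_left _ 1 this)
    rw [zero_sub] at h1
    refine h1.congr' ?_
    filter_upwards [eventually_le_atBot 0] with u hu
    have := hne t ht u hu
    field_simp
    ring
  have hzero : Tendsto (psiTransform μ) (𝓝[<] 0) (𝓝 0) := by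
    refine tendsto_psiTransform hμ
      (eventually_nhdsWithin_of_forall fun u (hu : u < 0) => hu.le) fun t ht => ?_
    have := (hat t ht 0 le_rfl).tendsto.mono_left (nhdsWithin_le_nhds (s := Iio 0))
    simpa using this
  obtain ⟨u, hu, hu0⟩ := ((hbot.eventually_lt_const hz.1).and (eventually_lt_atBot 0)).exists
  obtain ⟨v, hv, hv0, huv⟩ := ((hzero.eventually_const_lt hz.2).and
    (eventually_mem_nhdsWithin.and (eventually_nhdsWithin_of_eventually_nhds
      (eventually_gt_nhds hu0)))).exists
  have hv0' : v < 0 := hv0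
  have huv' : u < v := huv
  obtain ⟨w, hw, hwz⟩ := intermediate_value_Icc huv'.le
    (hcont.mono fun x hx => lt_of_le_of_lt hx.2 hv0') ⟨hu.le, hv.le⟩
  exact ⟨w, lt_of_le_of_lt hw.2 hv0', hwz⟩

theorem rpow_div_one_sub {c x : ℝ} (h0 : 0 < c) (hx : 0 < x) :
    (x ^ c / (1 + x ^ c) / (1 - x ^ c / (1 + x ^ c))) ^ (1 / c) = x := by
  have hr := rpow_pos_of_pos hx c
  have : x ^ c / (1 + x ^ c) / (1 - x ^ c / (1 + x ^ c)) = x ^ c := by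
    have : 1 - x ^ c / (1 + x ^ c) = 1 / (1 + x ^ c) := by
      field_simp
      ring
    rw [this]
    field_simp
  rw [this, ← rpow_mul hx.le, mul_one_div_cancel h0.ne', rpow_one]

theorem sTransform_formula_iff {α z χ : ℝ} (hz : z ∈ Ioo (-1 : ℝ) 0) :
    (z + 1) / z * χ = (-z) ^ α / (1 + z) ^ α ↔ χ = -(-z / (1 + z)) ^ (α + 1) := by
  have h1 : 0 < 1 + z := by linarith [hz.1]
  have h2 : 0 < -z := by linarith [hz.2]
  have h3 : z ≠ 0 := hz.2.ne
  rw [div_rpow h2.le h1.le, rpow_add_one h2.ne', rpow_add_one h1.ne']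
  have hp : (1 + z) ^ α ≠ 0 := (rpow_pos_of_pos h1 α).ne'
  rw [add_comm z 1]
  generalize (1 + z) ^ α = P at *
  generalize (-z) ^ α = Q at *
  rw [eq_div_iff hp]
  constructor
  · intro h
    field_simp at h ⊢
    linear_combination h
  · intro h
    rw [h]
    field_simp

/-- The maps `x ↦ -x^c/(1+x^c)` and `z ↦ (-z/(1+z))^(α+1)` are mutually inverse. Forwards, `χ` at
the first map's value is `-x`, and applying `ψ` gives the formula. Backwards, the formula for `ψ` at
the preimage `χ(z)` is solved for `χ(z)`. -/
theorem isMuAlphaBeta_iff_psiTransform {α : ℝ} (hα : 0 < α) {μ : Measure ℝ}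
    [hp : IsProbabilityMeasure μ] (hμ : μ (Iic 0) = 0) :
    IsMuAlphaBeta α α μ ↔
      ∀ x > 0, psiTransform μ (-x) = -(x ^ (1 / (α + 1)) / (1 + x ^ (1 / (α + 1)))) := by
  have hc : 0 < 1 / (α + 1) := by positivity
  have hmem : ∀ x : ℝ, 0 < x →
      -(x ^ (1 / (α + 1)) / (1 + x ^ (1 / (α + 1)))) ∈ Ioo (-1 : ℝ) 0 := by
    intro x hx
    have hr := rpow_pos_of_pos hx (1 / (α + 1))
    refine ⟨neg_lt_neg ((div_lt_one (by positivity)).2 (by linarith)), ?_⟩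
    rw [neg_lt_zero]
    positivity
  have hroot : ∀ x : ℝ, 0 < x →
      (x ^ (1 / (α + 1)) / (1 + x ^ (1 / (α + 1))) /
        (1 - x ^ (1 / (α + 1)) / (1 + x ^ (1 / (α + 1))))) ^ (α + 1) = x := by
    intro x hx
    have := rpow_div_one_sub hc hx
    rwa [one_div_one_div] at this
  constructor
  · intro h x hx
    have hz := hmem x hx
    have hs := (sTransform_formula_iff hz).1 (h.sTransform_eq _ hz)
    rw [neg_neg, ← sub_eq_add_neg, hroot x hx] at hs
    rw [← hs]
    exact Function.invFunOn_eq (exists_psiTransform_eq hμ hz)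
  · intro h
    refine ⟨hp, hμ, fun z hz => (sTransform_formula_iff hz).2 ?_⟩
    have hex := exists_psiTransform_eq hμ hz
    have hlt : chiTransform μ z < 0 := Function.invFunOn_mem hex
    have heq : psiTransform μ (chiTransform μ z) = z := Function.invFunOn_eq hex
    have hx := h (-chiTransform μ z) (by linarith)
    rw [neg_neg, heq] at hx
    have hr := hroot (-chiTransform μ z) (by linarith)
    rw [← neg_eq_iff_eq_neg.2 hx, sub_neg_eq_add] at hr
    linarith

theorem isMuAlphaBeta_muMeasure {α : ℝ} (hα : 0 < α) :
    IsMuAlphaBeta α α (muMeasure (1 / (α + 1))) := by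
  have h0 : 0 < 1 / (α + 1) := by positivity
  have h1 : 1 / (α + 1) < 1 := (div_lt_one (by positivity)).2 (by linarith)
  have := isProbabilityMeasure_muMeasure h0 h1
  exact (isMuAlphaBeta_iff_psiTransform hα (muMeasure_Iic_zero _)).2
    fun x hx => psiTransform_muMeasure h0 h1 hx

theorem IsMuAlphaBeta.eq_muMeasure {α : ℝ} (hα : 0 < α) {μ : Measure ℝ}
    (h : IsMuAlphaBeta α α μ) : μ = muMeasure (1 / (α + 1)) := by
  have h' := isMuAlphaBeta_muMeasure hα
  have := h.isProbabilityMeasure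
  have := h'.isProbabilityMeasure
  refine ext_of_psiTransform h.measure_Iic_zero h'.measure_Iic_zero fun u hu => ?_
  have e1 := (isMuAlphaBeta_iff_psiTransform hα h.measure_Iic_zero).1 h (-u) (by linarith)
  have e2 := (isMuAlphaBeta_iff_psiTransform hα h'.measure_Iic_zero).1 h' (-u) (by linarith)
  rw [neg_neg] at e1 e2
  rw [e1, e2]

/-! ### Explicit forms of the density. -/

theorem hasDensityOnIoi_muMeasure {c : ℝ} {f : ℝ → ℝ} (h : ∀ t > 0, muDensity c t = f t) :
    HasDensityOnIoi (muMeasure c) f := by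
  refine withDensity_congr_ae ?_
  filter_upwards [ae_restrict_mem measurableSet_Ioi] with t ht
  rw [h t ht]

theorem muDensity_half {t : ℝ} (ht : 0 < t) :
    muDensity (1 / (1 + 1)) t = 1 / (π * √t * (1 + t)) := by
  have hs := sq_sqrt ht.le
  rw [muDensity_eq ht, show π * (1 / (1 + 1)) = π / 2 by ring, sin_pi_div_two, cos_pi_div_two,
    show (1 : ℝ) / (1 + 1) = 1 / 2 by norm_num, ← sqrt_eq_rpow, hs, mul_zero, add_zero, mul_one]
  have h0 := sqrt_pos.2 ht
  have := pi_pos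
  rw [div_eq_div_iff (by positivity) (by positivity)]
  linear_combination π * (1 + t) * hs

theorem muDensity_third {t : ℝ} (ht : 0 < t) :
    muDensity (1 / (2 + 1)) t =
      √3 / (2 * π * (t ^ (2 / 3 : ℝ) + t + t ^ (4 / 3 : ℝ))) := by
  have h1 : t ^ (2 / 3 : ℝ) = t * t ^ (-(1 / (2 + 1)) : ℝ) := by
    nth_rw 2 [← rpow_one t]
    rw [← rpow_add ht]
    norm_num
  have h2 : t ^ (4 / 3 : ℝ) = t * t ^ (1 / (2 + 1) : ℝ) := by
    nth_rw 2 [← rpow_one t]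
    rw [← rpow_add ht]
    norm_num
  rw [muDensity, show π * (1 / (2 + 1)) = π / 3 by ring, sin_pi_div_three, cos_pi_div_three,
    h1, h2, div_div]
  congr 1
  ring

end

theorem mainTheorem10 :
    (∀ α : ℝ, 0 < α →
      (∃ μ : Measure ℝ, IsMuAlphaBeta α α μ) ∧
      ∀ μ : Measure ℝ, IsMuAlphaBeta α α μ →
        HasDensityOnIoi μ fun t =>
          Real.sin (Real.pi / (α + 1)) /
            (Real.pi * t *
              (t ^ (1 / (α + 1)) + 2 * Real.cos (Real.pi / (α + 1)) + t ^ (-(1 / (α + 1)))))) ∧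
    (∀ μ : Measure ℝ, IsMuAlphaBeta 1 1 μ →
      HasDensityOnIoi μ fun t => 1 / (Real.pi * Real.sqrt t * (1 + t))) ∧
    (∀ μ : Measure ℝ, IsMuAlphaBeta 2 2 μ →
      HasDensityOnIoi μ fun t =>
        Real.sqrt 3 /
          (2 * Real.pi * (t ^ (2 / 3 : ℝ) + t + t ^ (4 / 3 : ℝ)))) := by
  refine ⟨fun α hα => ⟨⟨_, isMuAlphaBeta_muMeasure hα⟩, fun μ hμ => ?_⟩, fun μ hμ => ?_,
    fun μ hμ => ?_⟩
  · rw [hμ.eq_muMeasure hα]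
    exact hasDensityOnIoi_muMeasure fun t _ => by rw [muDensity, mul_one_div]
  · rw [hμ.eq_muMeasure one_pos]
    exact hasDensityOnIoi_muMeasure fun t ht => muDensity_half ht
  · rw [hμ.eq_muMeasure two_pos]
    exact hasDensityOnIoi_muMeasure fun t ht => muDensity_third ht
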